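/- Theorem 4.1. For nonempty sets $X,Y$ let $\mathcal P(X,Y)$ be the set of all partial functions from $X$ to $Y$. For $f,g\in\mathcal P(X,Y)$, the override $f\sqcup g$ is the partial function that equals $f$ on $\operatorname{dom}(f)$, equals $g$ on $\operatorname{dom}(g)\setminus\operatorname{dom}(f)$, and is undefined elsewhere; the update $f[g]$ is the restriction of $g\sqcup f$ to $\operatorname{dom}(f)$. An algebra $A$ with two binary operations $\sqcup$ and $\_[\_]$ is called representable if it is isomorphic to a subalgebra of $\langle\mathcal P(X,Y);\sqcup,\_[\_]\rangle$ for some nonempty sets $X,Y$. Then an algebra with two binary operations $\sqcup$ and $\_[\_]$ is representable if and only if it satisfies the following eight equations: \begin{align*} x&=x[x\sqcup y], & x\sqcup y&=y[x]\sqcup x,\\ x[y][z]&=x[z\sqcup y], & (x\sqcup y)[z]&=x[z]\sqcup y[z],\\ x[y[x[z]]]&=x[y[x][z]], & w[x[y[w[z]]]]&=w[x[y[w][z]]],\\ (x\sqcup y)\sqcup z&=x\sqcup(y\sqcup z), & x\sqcup x&=x. \end{align*} Consequently the class of representable algebras is a finitely based variety: it is a nonempty class closed under homomorphic images, subalgebras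 and direct products, and it is axiomatised by a finite set of equations. -/

import Mathlib

open scoped FirstOrder

universe u

/-- The operation symbols of the signature of override and update, both binary. -/
inductive OUFunctions : ℕ → Type
  | override : OUFunctions 2
  | update : OUFunctions 2

/-- The signature of override and update: two binary operation symbols and no relation symbols. -/
def OULang : FirstOrder.Language.{0, 0} := ⟨OUFunctions, fun _ => Empty⟩

/-! ### Override and update of partial functions -/

namespace PartialFunction

variable {X Y : Type*}

open Classical in
/-- Override `f ⊔ g`: equal to `f` on the domain of `f`, to `g` on the rest of the domain of `g`,
and undefined elsewhere. -/
noncomputable def override (f g : X →. Y) : X →. Y := fun x => if (f x).Dom then f x else g x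

theorem dom_subset_dom_override (f g : X →. Y) : f.Dom ⊆ (override g f).Dom := by
  intro x hx
  by_cases h : (g x).Dom
  · simp [PFun.Dom, override, h]
  · simpa [PFun.Dom, override, h] using hx

/-- Update `f[g]`: the restriction of `g ⊔ f` to the domain of `f`. -/
noncomputable def update (f g : X →. Y) : X →. Y :=
  (override g f).restrict (dom_subset_dom_override f g)

/-- The algebra of all partial functions from `X` to `Y`. -/
noncomputable instance : OULang.Structure (X →. Y) where
  funMap := fun {_} s =>
    match s with
    | OUFunctions.override => fun a => override (a 0) (a 1)
    | OUFunctions.update => fun a => update (a 0) (a 1)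
  RelMap := fun r => Empty.elim r

end PartialFunction

/-- An algebra is representable if it is isomorphic to an algebra of partial functions, that is,
to a subalgebra of the algebra of all partial functions from `X` to `Y` for some nonempty sets
`X` and `Y`. -/
def IsRepresentable (A : Type u) [OULang.Structure A] : Prop :=
  ∃ X Y : Type u, Nonempty X ∧ Nonempty Y ∧
    ∃ S : OULang.Substructure (X →. Y), Nonempty (A ≃[OULang] S)

/-! ### Equations and varieties -/

/-- An equation between two terms in variables indexed by `ℕ`. -/
structure Equation (L : FirstOrder.Language.{0, 0}) where
  lhs : L.Term ℕ
  rhs : L.Term ℕ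

/-- An equation holds in an algebra if both sides agree under every assignment. -/
def Equation.Holds {L : FirstOrder.Language.{0, 0}} (e : Equation L) (A : Type u) [L.Structure A] : Prop :=
  ∀ v : ℕ → A, e.lhs.realize v = e.rhs.realize v

/-- The set `E` of equations axiomatises the class `K`: the members of `K` are exactly the algebras
in which all the equations of `E` hold. -/
def Axiomatises {L : FirstOrder.Language.{0, 0}} (E : Set (Equation L))
    (K : ∀ (A : Type u) [L.Structure A], Prop) : Prop :=
  ∀ (A : Type u) [L.Structure A], (∀ e ∈ E, e.Holds A) ↔ K A

/-- The direct product of a family of algebras, with coordinatewise operations. -/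
abbrev productStructure (L : FirstOrder.Language.{0, 0}) {ι : Type u} (A : ι → Type u)
    [∀ i, L.Structure (A i)] : L.Structure (∀ i, A i) where
  funMap := fun s a i => FirstOrder.Language.Structure.funMap s (fun k => a k i)
  RelMap := fun r a => ∀ i, FirstOrder.Language.Structure.RelMap r (fun k => a k i)

/-- A variety: a nonempty class of algebras closed under homomorphic images, subalgebras and direct
products. -/
structure IsVariety {L : FirstOrder.Language.{0, 0}} (K : ∀ (A : Type u) [L.Structure A], Prop) : Prop where
  nonempty : ∃ (A : Type u) (_ : L.Structure A), Nonempty A ∧ K A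
  image : ∀ (A B : Type u) [L.Structure A] [L.Structure B] (f : A →[L] B),
    Function.Surjective f → K A → K B
  subalgebra : ∀ (A : Type u) [L.Structure A] (S : L.Substructure A), K A → K S
  product : ∀ (ι : Type u) (A : ι → Type u) [∀ i, L.Structure (A i)],
    (∀ i, K (A i)) → @K (∀ i, A i) (productStructure L A)

/-- A finitely based variety: a variety axiomatised by some finite set of equations. -/
def IsFinitelyBasedVariety {L : FirstOrder.Language.{0, 0}} (K : ∀ (A : Type u) [L.Structure A], Prop) :
    Prop :=
  IsVariety K ∧ ∃ E : Set (Equation L), E.Finite ∧ Axiomatises E K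

/-! ### The laws -/

/-- Terms in the signature of override and update. -/
abbrev OUTerm : Type := OULang.Term ℕ

namespace OUTerm

/-- The term `s ⊔ t`. -/
def ov (s t : OUTerm) : OUTerm :=
  FirstOrder.Language.Functions.apply₂ (L := OULang) OUFunctions.override s t

/-- The term `s[t]`. -/
def upd (s t : OUTerm) : OUTerm :=
  FirstOrder.Language.Functions.apply₂ (L := OULang) OUFunctions.update s t

/-- The variable `x`. -/
def x : OUTerm := FirstOrder.Language.Term.var 0

/-- The variable `y`. -/
def y : OUTerm := FirstOrder.Language.Term.var 1

/-- The variable `z`. -/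
def z : OUTerm := FirstOrder.Language.Term.var 2

/-- The variable `w`. -/
def w : OUTerm := FirstOrder.Language.Term.var 3

end OUTerm

open OUTerm in
/-- The laws, in order:
`x = x[x ⊔ y]`,
`x ⊔ y = y[x] ⊔ x`,
`x[y][z] = x[z ⊔ y]`,
`(x ⊔ y)[z] = x[z] ⊔ y[z]`,
`x[y[x[z]]] = x[y[x][z]]`,
`w[x[y[w[z]]]] = w[x[y[w][z]]]`,
`(x ⊔ y) ⊔ z = x ⊔ (y ⊔ z)`,
`x ⊔ x = x`. -/
def overrideUpdateLaws : Set (Equation OULang) :=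
  { ⟨x, upd x (ov x y)⟩,
    ⟨ov x y, ov (upd y x) x⟩,
    ⟨upd (upd x y) z, upd x (ov z y)⟩,
    ⟨upd (ov x y) z, ov (upd x z) (upd y z)⟩,
    ⟨upd x (upd y (upd x z)), upd x (upd (upd y x) z)⟩,
    ⟨upd w (upd x (upd y (upd w z))), upd w (upd x (upd (upd y w) z))⟩,
    ⟨ov (ov x y) z, ov x (ov y z)⟩,
    ⟨ov x x, x⟩ }

/-! ### Override-update algebras -/

/-! Partial functions satisfy the laws pointwise, and equations pass to images, subalgebras and
products. Conversely, it suffices to separate distinct `a`, `b` by a homomorphism to partial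
functions on one point: one point per pair then gives an embedding (`exists_embedding`).

If one domain is not contained in the other, `isPointHom_principal` separates them. Otherwise divide
by a congruence maximal among those omitting `(a, b)`. Each kernel of `c ⊔ _` is a congruence, so in
the quotient every `c` with `c ⊔ a ≠ c ⊔ b` is a left identity and can be left undefined at the
point. The remaining elements form `D`; their values are the classes generated by `x ~ x ⊔ y` for `x
∈ D`. If `a` and `b` had the same value, a chain of compatible elements of `D` would join them, and
nested updates along it would force `a = b` (`Critical.eq_of_reflTransGen`). -/

/-- Algebras satisfying the laws of override and update (the law in four variables
follows from the others). -/
class OverrideUpdateAlgebra (A : Type*) where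
  ov : A → A → A
  upd : A → A → A
  upd_ov_self : ∀ x y, upd x (ov x y) = x
  ov_eq : ∀ x y, ov x y = ov (upd y x) x
  upd_upd : ∀ x y z, upd (upd x y) z = upd x (ov z y)
  ov_upd : ∀ x y z, upd (ov x y) z = ov (upd x z) (upd y z)
  upd_upd_upd : ∀ x y z, upd x (upd y (upd x z)) = upd x (upd (upd y x) z)
  ov_assoc : ∀ x y z, ov (ov x y) z = ov x (ov y z)
  ov_self : ∀ x, ov x x = x

namespace OverrideUpdateAlgebra

local infixl:65 " ⋎ " => OverrideUpdateAlgebra.ov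
local infixl:70 " ◁ " => OverrideUpdateAlgebra.upd

section Basic

variable {A : Type*} [OverrideUpdateAlgebra A]

/-! ### Elementary identities -/

theorem upd_self (x : A) : x ◁ x = x := by
  have h := upd_ov_self x x
  rwa [ov_self] at h

theorem ov_ov_left (x y : A) : x ⋎ (x ⋎ y) = x ⋎ y := by
  rw [← ov_assoc, ov_self]

theorem ov_ov_self (x y : A) : x ⋎ y ⋎ x = x ⋎ y := by
  rw [ov_eq x y, ov_assoc, ov_self]

theorem upd_upd_cancel (x y : A) : x ◁ y ◁ x = x := by
  rw [upd_upd, upd_ov_self]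

theorem ov_upd_right (x y : A) : x ⋎ (x ◁ y) = x := by
  rw [ov_eq, upd_upd_cancel, ov_self]

theorem upd_ov_left (x y : A) : x ◁ y ⋎ x = x ◁ y := by
  have h := ov_upd_right (x ◁ y) x
  rwa [upd_upd_cancel] at h

theorem ov_upd_eq (x y : A) : x ⋎ (y ◁ x) = x ⋎ y := by
  rw [← ov_ov_left x y, ov_eq x y, ← ov_assoc, ov_ov_self]

theorem upd_upd_self (x w : A) : x ◁ (w ◁ x) = x := by
  have h := upd_ov_self x w
  rwa [ov_eq, ← upd_upd, upd_self] at h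

theorem ov_upd_self (x y : A) : (x ⋎ y) ◁ x = x ⋎ y := by
  rw [ov_upd, upd_self, ov_upd_eq]

/-! ### Equality of domains and iterated updates -/

/-- Two elements have the same domain. -/
def SameDom (x y : A) : Prop := x ⋎ y = x ∧ y ⋎ x = y

theorem SameDom.refl (x : A) : SameDom x x := ⟨ov_self x, ov_self x⟩

theorem SameDom.symm {x y : A} (h : SameDom x y) : SameDom y x := ⟨h.2, h.1⟩

theorem SameDom.trans {x y z : A} (h : SameDom x y) (k : SameDom y z) : SameDom x z := by
  constructor
  · rw [← h.1, ov_assoc, k.1]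
  · rw [← k.2, ov_assoc, h.2]

theorem sameDom_upd (x y : A) : SameDom x (x ◁ y) := ⟨ov_upd_right x y, upd_ov_left x y⟩

theorem SameDom.upd_eq {c w : A} (h : SameDom c w) : w ◁ c = c := by
  have h1 : w ◁ c ⋎ c = w ◁ c := ((sameDom_upd w c).symm.trans h.symm).1
  rw [← h1, ← ov_eq, h.1]

/-- Two elements act in the same way by update on all elements with the domain of `c`. -/
def Agree (c s t : A) : Prop := ∀ w, SameDom c w → w ◁ s = w ◁ t

theorem agree_ov (c z : A) : Agree c c (c ⋎ z) := by
  intro w hw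
  rw [← upd_upd, hw.upd_eq, (hw.trans (sameDom_upd w z)).upd_eq]

/-- By `upd_upd_upd`, `r` affects `w[x[r]]` only through `w[x][r]`, and `w[x]` has the same domain
as `w`. -/
theorem Agree.upd {c s t : A} (h : Agree c s t) (x : A) : Agree c (x ◁ s) (x ◁ t) := by
  have key : ∀ w r : A, w ◁ (x ◁ r) = w ◁ x ◁ (x ◁ (w ◁ x ◁ r)) := by
    intro w r
    rw [upd_upd_upd (w ◁ x) x r, upd_upd_self, upd_upd, upd_ov_left]
  intro w hw
  rw [key w s, key w t, h (w ◁ x) (hw.trans (sameDom_upd w x))]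

/-- The iterated update `x₁[x₂[…[xₙ[z]]…]]`. -/
def nest (l : List A) (z : A) : A := l.foldr OverrideUpdateAlgebra.upd z

theorem nest_cons (x : A) (l : List A) (z : A) : nest (x :: l) z = x ◁ nest l z := rfl

theorem Agree.nest {c s t : A} (h : Agree c s t) (l : List A) :
    Agree c (nest l s) (nest l t) := by
  induction l with
  | nil => exact h
  | cons x l ih => exact ih.upd x

/-- Two elements agree on the intersection of their domains. -/
def Compat (x y : A) : Prop := x ◁ y = x ∧ y ◁ x = y

theorem compat_ov (x y : A) : Compat x (x ⋎ y) := ⟨upd_ov_self x y, ov_upd_self x y⟩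

/-- Under the outer `a`, the innermost `a` can be replaced by `a ⊔ x`, which is `x ⊔ a` by
compatibility, and then, under `x`, by `x`: the seed moves along the chain. -/
theorem upd_nest_self (l : List A) (a : A) (h : (a :: l).IsChain Compat) :
    a ◁ nest l a = a := by
  induction l generalizing a with
  | nil => exact upd_self a
  | cons x l ih =>
    rw [List.isChain_cons_cons] at h
    have hc : a ⋎ x = x ⋎ a := by rw [ov_eq, h.1.2]
    rw [(agree_ov a x).nest (x :: l) a (SameDom.refl a), hc, nest_cons,
      ← (agree_ov x a).nest l x (SameDom.refl x), ih x h.2, h.1.1]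

/-! ### Critical pairs -/

/-- Elements with the same domain that become equal after an update by any element of `D`. -/
def Critical (D : Set A) (a b : A) : Prop := SameDom a b ∧ ∀ c ∈ D, a ◁ c = b ◁ c

/-- Since `x[a][c] = x[c ⊔ a]` and `c ⊔ a = a[c] ⊔ c`, only `a[c]` matters. -/
theorem Critical.upd {D : Set A} {a b x : A} (h : Critical D a b) :
    Critical D (x ◁ a) (x ◁ b) := by
  refine ⟨(sameDom_upd x a).symm.trans (sameDom_upd x b), fun c hc => ?_⟩
  rw [upd_upd, upd_upd, ov_eq c a, ov_eq c b, h.2 c hc]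

/-- Recover `a` as `a[x[a]] = a[x[b]]`; as `x[b] ∈ D`, this is `b[x[b]] = b`. -/
theorem Critical.upd_injective {D : Set A} (hD : ∀ x ∈ D, ∀ y, x ◁ y ∈ D) {a b x : A}
    (h : Critical D a b) (hx : x ∈ D) (he : x ◁ a = x ◁ b) : a = b := by
  rw [← upd_upd_self a x, he, h.2 _ (hD x hx b), upd_upd_self]

theorem Critical.nest {D : Set A} {a b : A} (h : Critical D a b) (l : List A) :
    Critical D (nest l a) (nest l b) := by
  induction l with
  | nil => exact h
  | cons x l ih => exact ih.upd

theorem Critical.nest_injective {D : Set A} (hD : ∀ x ∈ D, ∀ y, x ◁ y ∈ D) {a b : A}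
    (h : Critical D a b) (l : List A) (hl : ∀ x ∈ l, x ∈ D)
    (he : OverrideUpdateAlgebra.nest l a = OverrideUpdateAlgebra.nest l b) : a = b := by
  induction l with
  | nil => exact he
  | cons x l ih =>
    exact ih (fun y hy => hl y (List.mem_cons_of_mem x hy))
      ((h.nest l).upd_injective hD (hl x List.mem_cons_self) he)

/-- Compatible elements of `D`. -/
def CompatIn (D : Set A) (x y : A) : Prop := x ∈ D ∧ y ∈ D ∧ Compat x y

theorem exists_chain {D : Set A} {a b : A} (h : Relation.ReflTransGen (CompatIn D) a b) :
    ∃ l : List A, (∀ x ∈ l, x ∈ D) ∧ (a :: l).IsChain Compat ∧ a ◁ nest l b = a := by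
  induction h using Relation.ReflTransGen.head_induction_on with
  | refl => exact ⟨[], by simp, by simp, upd_self b⟩
  | @head a c hac _ ih =>
    obtain ⟨l, hl, hc, he⟩ := ih
    refine ⟨c :: l, ?_, ?_, ?_⟩
    · intro x hx
      rcases List.mem_cons.1 hx with rfl | hx
      · exact hac.2.1
      · exact hl x hx
    · exact List.isChain_cons_cons.2 ⟨hac.2.2, hc⟩
    · rw [nest_cons, he, hac.2.2.1]

/-- Critical elements of `D` that are joined by a path of compatible elements of `D` are equal. -/
theorem Critical.eq_of_reflTransGen {D : Set A} (hD : ∀ x ∈ D, ∀ y, x ◁ y ∈ D) {a b : A}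
    (h : Critical D a b) (ha : a ∈ D) (hab : Relation.ReflTransGen (CompatIn D) a b) : a = b := by
  obtain ⟨l, hl, hc, he⟩ := exists_chain hab
  refine h.nest_injective hD l hl ?_
  -- Both nested terms are fixed under update by `a`, and criticality makes these updates equal
  -- because `a ∈ D`.
  have h1 := upd_upd_self (OverrideUpdateAlgebra.nest l a) a
  have h2 := upd_upd_self (OverrideUpdateAlgebra.nest l b) a
  rw [upd_nest_self l a hc] at h1
  rw [he] at h2
  rw [← h1, ← h2, (h.nest l).2 a ha]

/-! ### Congruences and quotients -/

/-- Congruences, as sets of pairs. -/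
structure IsCongruence (r : Set (A × A)) : Prop where
  refl : ∀ x, (x, x) ∈ r
  symm : ∀ {x y}, (x, y) ∈ r → (y, x) ∈ r
  trans : ∀ {x y z}, (x, y) ∈ r → (y, z) ∈ r → (x, z) ∈ r
  ov : ∀ {x x' y y'}, (x, x') ∈ r → (y, y') ∈ r → (x ⋎ y, x' ⋎ y') ∈ r
  upd : ∀ {x x' y y'}, (x, x') ∈ r → (y, y') ∈ r → (x ◁ y, x' ◁ y') ∈ r

/-- Writing `c ⊔ x'` as `x'[c] ⊔ c` brings `c` next to `y`. -/
theorem ov_left_congr_ov {c x x' y y' : A} (hx : c ⋎ x = c ⋎ x') (hy : c ⋎ y = c ⋎ y') :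
    c ⋎ (x ⋎ y) = c ⋎ (x' ⋎ y') := by
  rw [← ov_assoc, hx, ov_eq c x', ov_assoc, hy, ← ov_assoc, ← ov_eq, ov_assoc]

theorem ov_left_congr_upd {c x x' y y' : A} (hx : c ⋎ x = c ⋎ x') (hy : c ⋎ y = c ⋎ y') :
    c ⋎ (x ◁ y) = c ⋎ (x' ◁ y') := by
  have h1 : ∀ z, c ⋎ (z ◁ y) = c ⋎ ((c ⋎ z) ◁ y) := by
    intro z
    rw [ov_upd, ← ov_assoc, ov_upd_right]
  -- The second argument is exchanged via `x'[y][c] = x'[c ⊔ y]`.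
  rw [h1 x, hx, ← h1 x', ov_eq c (x' ◁ y), ov_eq c (x' ◁ y'), upd_upd, upd_upd, hy]

/-- Every pair of distinct elements is avoided by a maximal congruence. -/
theorem exists_maximal_congruence {a b : A} (hab : a ≠ b) :
    ∃ r : Set (A × A), Maximal (fun r => IsCongruence r ∧ (a, b) ∉ r) r := by
  obtain ⟨m, -, hm⟩ := zorn_subset_nonempty {r : Set (A × A) | IsCongruence r ∧ (a, b) ∉ r} (by
    intro C hC hchain hne
    obtain ⟨r₀, hr₀⟩ := hne
    have hpair : ∀ {p q : A × A}, p ∈ ⋃₀ C → q ∈ ⋃₀ C → ∃ r ∈ C, p ∈ r ∧ q ∈ r := by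
      rintro p q ⟨r, hr, hp⟩ ⟨s, hs, hq⟩
      rcases hchain.total hr hs with h | h
      · exact ⟨s, hs, h hp, hq⟩
      · exact ⟨r, hr, hp, h hq⟩
    refine ⟨⋃₀ C, ⟨⟨?_, ?_, ?_, ?_, ?_⟩, ?_⟩, fun s hs => Set.subset_sUnion_of_mem hs⟩
    · exact fun x => ⟨r₀, hr₀, (hC hr₀).1.refl x⟩
    · rintro x y ⟨r, hr, h⟩
      exact ⟨r, hr, (hC hr).1.symm h⟩
    · intro x y z hx hy
      obtain ⟨r, hr, h, k⟩ := hpair hx hy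
      exact ⟨r, hr, (hC hr).1.trans h k⟩
    · intro x x' y y' hx hy
      obtain ⟨r, hr, h, k⟩ := hpair hx hy
      exact ⟨r, hr, (hC hr).1.ov h k⟩
    · intro x x' y y' hx hy
      obtain ⟨r, hr, h, k⟩ := hpair hx hy
      exact ⟨r, hr, (hC hr).1.upd h k⟩
    · rintro ⟨r, hr, h⟩
      exact (hC hr).2 h) {p | p.1 = p.2}
    ⟨⟨fun _ => rfl, fun h => h.symm, fun h k => h.trans k,
      fun h k => congrArg₂ OverrideUpdateAlgebra.ov h k,
      fun h k => congrArg₂ OverrideUpdateAlgebra.upd h k⟩, hab⟩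
  exact ⟨m, hm⟩

/-- The equivalence relation underlying a congruence. -/
abbrev IsCongruence.setoid {r : Set (A × A)} (hr : IsCongruence r) : Setoid A :=
  ⟨fun x y => (x, y) ∈ r, hr.refl, hr.symm, hr.trans⟩

/-- The quotient of an override-update algebra by a congruence. -/
abbrev IsCongruence.quotient {r : Set (A × A)} (hr : IsCongruence r) :
    OverrideUpdateAlgebra (Quotient hr.setoid) where
  ov := Quotient.map₂ OverrideUpdateAlgebra.ov fun _ _ h _ _ k => hr.ov h k
  upd := Quotient.map₂ OverrideUpdateAlgebra.upd fun _ _ h _ _ k => hr.upd h k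
  upd_ov_self := by
    rintro ⟨x⟩ ⟨y⟩
    exact congrArg (Quotient.mk hr.setoid) (upd_ov_self x y)
  ov_eq := by
    rintro ⟨x⟩ ⟨y⟩
    exact congrArg (Quotient.mk hr.setoid) (ov_eq x y)
  upd_upd := by
    rintro ⟨x⟩ ⟨y⟩ ⟨z⟩
    exact congrArg (Quotient.mk hr.setoid) (upd_upd x y z)
  ov_upd := by
    rintro ⟨x⟩ ⟨y⟩ ⟨z⟩
    exact congrArg (Quotient.mk hr.setoid) (ov_upd x y z)
  upd_upd_upd := by
    rintro ⟨x⟩ ⟨y⟩ ⟨z⟩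
    exact congrArg (Quotient.mk hr.setoid) (upd_upd_upd x y z)
  ov_assoc := by
    rintro ⟨x⟩ ⟨y⟩ ⟨z⟩
    exact congrArg (Quotient.mk hr.setoid) (ov_assoc x y z)
  ov_self := by
    rintro ⟨x⟩
    exact congrArg (Quotient.mk hr.setoid) (ov_self x)

end Basic

/-! ### Representations at a point -/

section Point

open Classical in
/-- Override of partially defined values. -/
noncomputable def partOv {Y : Type*} (p q : Part Y) : Part Y := if p.Dom then p else q

open Classical in
/-- Update of partially defined values. -/
noncomputable def partUpd {Y : Type*} (p q : Part Y) : Part Y :=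
  if p.Dom then partOv q p else Part.none

/-- A homomorphism to the algebra of partial functions on a point. -/
structure IsPointHom {A Y : Type*} [OverrideUpdateAlgebra A] (h : A → Part Y) : Prop where
  ov : ∀ x y, h (x ⋎ y) = partOv (h x) (h y)
  upd : ∀ x y, h (x ◁ y) = partUpd (h x) (h y)

theorem part_eq_none {Y : Type*} {p : Part Y} (h : ¬ p.Dom) : p = Part.none :=
  Part.eq_none_iff'.2 h

theorem IsPointHom.map {A Y Z : Type*} [OverrideUpdateAlgebra A] {h : A → Part Y}
    (hh : IsPointHom h) (f : Y → Z) : IsPointHom fun x => (h x).map f := by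
  constructor
  · intro x y
    by_cases hx : (h x).Dom <;> simp [hh.ov, partOv, hx]
  · intro x y
    by_cases hx : (h x).Dom <;> by_cases hy : (h y).Dom <;>
      simp [hh.upd, partUpd, partOv, hx, hy]

theorem isPointHom_of_set {A Y : Type*} [OverrideUpdateAlgebra A] (D : Set A) (f : A → Y)
    (hov : ∀ x y, x ⋎ y ∈ D ↔ x ∈ D ∨ y ∈ D) (hupd : ∀ x y, x ◁ y ∈ D ↔ x ∈ D)
    (h₁ : ∀ x ∈ D, ∀ y, f (x ⋎ y) = f x) (h₂ : ∀ x ∉ D, ∀ y ∈ D, f (x ⋎ y) = f y)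
    (h₃ : ∀ x ∈ D, ∀ y ∈ D, f (x ◁ y) = f y) (h₄ : ∀ x ∈ D, ∀ y ∉ D, f (x ◁ y) = f x) :
    IsPointHom fun x => (⟨x ∈ D, fun _ => f x⟩ : Part Y) := by
  constructor
  · intro x y
    by_cases hx : x ∈ D
    · simp only [partOv, hx, if_true]
      exact Part.ext' (by simp [hov, hx]) fun _ _ => h₁ x hx y
    · simp only [partOv, hx, if_false]
      exact Part.ext' (by simp [hov, hx]) fun _ hy => h₂ x hx y hy
  · intro x y
    by_cases hx : x ∈ D
    · by_cases hy : y ∈ D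
      · simp only [partUpd, partOv, hx, hy, if_true]
        exact Part.ext' (by simp [hupd, hx, hy]) fun _ _ => h₃ x hx y hy
      · simp only [partUpd, partOv, hx, hy, if_true, if_false]
        exact Part.ext' (by simp [hupd, hx]) fun _ _ => h₄ x hx y hy
    · simp only [partUpd, hx, if_false]
      exact part_eq_none (by simp [hupd, hx])

/-- The complement of a principal ideal gives a representation at a point. -/
theorem isPointHom_principal {A : Type u} [OverrideUpdateAlgebra A] (a : A) :
    IsPointHom fun x => (⟨a ⋎ x ≠ a, fun _ => PUnit.unit⟩ : Part PUnit.{u + 1}) := by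
  refine isPointHom_of_set {x | a ⋎ x ≠ a} (fun _ => PUnit.unit) ?_ ?_ (fun _ _ _ => rfl)
    (fun _ _ _ _ => rfl) (fun _ _ _ _ => rfl) (fun _ _ _ _ => rfl)
  · intro x y
    simp only [Set.mem_ofPred_eq, ← not_and_or, not_iff_not, ne_eq]
    constructor
    · intro h
      have hx : a ⋎ x = a := by
        rw [← h, ov_assoc, ov_ov_self]
      exact ⟨hx, by rwa [← ov_assoc, hx] at h⟩
    · rintro ⟨hx, hy⟩
      rw [← ov_assoc, hx, hy]
  · intro x y
    simp only [Set.mem_ofPred_eq, not_iff_not, ne_eq]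
    constructor
    · intro h
      rw [← h, ov_assoc, upd_ov_left]
    · intro h
      rw [← h, ov_assoc, ov_upd_right]

/-- If `c ↦ c ⊔ x` is injective for every `c` with `c ⊔ a ≠ c ⊔ b`, then distinct elements `a`,
`b` with the same domain are separated by a representation at a point. -/
theorem exists_pointHom_of_irreducible {B : Type u} [OverrideUpdateAlgebra B] {a b : B}
    (hab : a ≠ b) (hs : SameDom a b)
    (hirr : ∀ c, c ⋎ a ≠ c ⋎ b → ∀ x, c ⋎ x = x) :
    ∃ (Y : Type u) (h : B → Part Y), IsPointHom h ∧ h a ≠ h b := by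
  let D : Set B := {c | c ⋎ a = c ⋎ b}
  have hD : ∀ c, c ∈ D ↔ c ⋎ a = c ⋎ b := fun _ => Iff.rfl
  have hzero : ∀ c ∉ D, ∀ x, c ⋎ x = x := fun c hc => hirr c hc
  have hleft : ∀ x ∈ D, ∀ y, x ⋎ y ∈ D := by
    intro x hx y
    rw [hD] at hx ⊢
    rw [ov_eq x y, ov_assoc, hx, ov_assoc]
  have hright : ∀ x, ∀ y ∈ D, x ⋎ y ∈ D := by
    intro x y hy
    rw [hD] at hy ⊢
    rw [ov_assoc, hy, ov_assoc]
  have hupd : ∀ x y, x ◁ y ∈ D ↔ x ∈ D := by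
    intro x y
    constructor
    · intro h
      rw [← ov_upd_right x y]
      exact hright x _ h
    · intro h
      rw [← upd_ov_left x y]
      exact hright _ x h
  have ha : a ∈ D := by rw [hD, ov_self, hs.1]
  have hb : b ∈ D := by rw [hD, ov_self, hs.2]
  let R : B → B → Prop := fun x z => x ∈ D ∧ ∃ y, z = x ⋎ y
  have hR : ∀ x ∈ D, ∀ y, Quot.mk R (x ⋎ y) = Quot.mk R x :=
    fun x hx y => (Quot.sound ⟨hx, y, rfl⟩).symm
  refine ⟨Quot R, fun x => ⟨x ∈ D, fun _ => Quot.mk R x⟩,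
    isPointHom_of_set D (Quot.mk R) ?_ hupd hR ?_ ?_ ?_, ?_⟩
  · intro x y
    constructor
    · intro h
      by_cases hx : x ∈ D
      · exact Or.inl hx
      · rw [hzero x hx] at h
        exact Or.inr h
    · rintro (h | h)
      · exact hleft x h y
      · exact hright x y h
  · intro x hx y _
    rw [hzero x hx]
  · intro x hx y hy
    -- The chain is `x[y] ~ x[y] ⊔ y = y ⊔ x ~ y`.
    rw [← hR (x ◁ y) ((hupd x y).2 hx) y, ← ov_eq, hR y hy]
  · intro x _ y hy
    have h := upd_upd x x y
    rw [upd_self, hzero y hy, upd_self] at h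
    rw [h]
  · intro he
    have hpath : ∀ x y, Relation.EqvGen R x y → Relation.ReflTransGen (CompatIn D) x y := by
      have hsymm : Std.Symm (CompatIn D) :=
        ⟨fun x y h => ⟨h.2.1, h.1, h.2.2.2, h.2.2.1⟩⟩
      intro x y hxy
      induction hxy with
      | rel x y h =>
        obtain ⟨hx, z, rfl⟩ := h
        exact Relation.ReflTransGen.single ⟨hx, hleft x hx z, compat_ov x z⟩
      | refl x => exact Relation.ReflTransGen.refl
      | symm x y _ ih => exact Std.Symm.symm _ _ ih
      | trans x y z _ _ ih₁ ih₂ => exact ih₁.trans ih₂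
    replace hpath := hpath a b (Quot.eqvGen_exact (Part.get_eq_get_of_eq _ ha he))
    refine hab (Critical.eq_of_reflTransGen (fun x hx y => (hupd x y).2 hx) ⟨hs, ?_⟩ ha hpath)
    intro c hc
    -- Updating `a` by both sides gives `a[a][c] = a[b][c]`, and `a[b] = b` as the domains coincide.
    have h := congrArg (fun t => a ◁ t) hc
    simp only [← upd_upd, upd_self, hs.symm.upd_eq] at h
    exact h

/-- Distinct elements are separated by a representation at a point. -/
theorem exists_pointHom {A : Type u} [OverrideUpdateAlgebra A] {a b : A} (hab : a ≠ b) :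
    ∃ (Y : Type u) (h : A → Part Y), IsPointHom h ∧ h a ≠ h b := by
  by_cases h₁ : a ⋎ b = a
  swap
  · refine ⟨_, _, isPointHom_principal a, fun h => ?_⟩
    have := congrArg Part.Dom h
    simp [ov_self, h₁] at this
  by_cases h₂ : b ⋎ a = b
  swap
  · refine ⟨_, _, isPointHom_principal b, fun h => ?_⟩
    have := congrArg Part.Dom h
    simp [ov_self, h₂] at this
  obtain ⟨r, ⟨hr, hrab⟩, hmax⟩ := exists_maximal_congruence hab
  let := hr.quotient
  let π : A → Quotient hr.setoid := Quotient.mk hr.setoid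
  have hπ : ∀ x y, π x = π y ↔ (x, y) ∈ r := fun x y => Quotient.eq
  have hπov : ∀ x y, π (x ⋎ y) = π x ⋎ π y := fun _ _ => rfl
  have hπupd : ∀ x y, π (x ◁ y) = π x ◁ π y := fun _ _ => rfl
  obtain ⟨Y, h, hh, hne⟩ := exists_pointHom_of_irreducible (a := π a) (b := π b)
    (fun h => hrab ((hπ a b).1 h))
    ⟨by rw [← hπov, h₁], by rw [← hπov, h₂]⟩ (by
      intro c hc x
      obtain ⟨x, rfl⟩ := Quotient.exists_rep x
      have hle : r ⊆ {p : A × A | c ⋎ π p.1 = c ⋎ π p.2} := by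
        rintro ⟨x, y⟩ hxy
        exact congrArg (fun t => c ⋎ t) ((hπ x y).2 hxy)
      have hcong : IsCongruence {p : A × A | c ⋎ π p.1 = c ⋎ π p.2} :=
        { refl := fun _ => rfl
          symm := fun h => h.symm
          trans := fun h k => h.trans k
          ov := fun h k => ov_left_congr_ov h k
          upd := fun h k => ov_left_congr_upd h k }
      obtain ⟨c, rfl⟩ := Quotient.exists_rep c
      -- As `c ⊔ _` is idempotent, its kernel relates `c ⊔ x` to `x`; by maximality so does `r`.
      exact (hπ (c ⋎ x) x).2 (hmax ⟨hcong, hc⟩ hle (ov_ov_left (π c) (π x))))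
  exact ⟨Y, fun x => h (π x), ⟨fun x y => hh.ov (π x) (π y), fun x y => hh.upd (π x) (π y)⟩, hne⟩

/-- Every override-update algebra embeds into an algebra of partial functions. -/
theorem exists_embedding (A : Type u) [OverrideUpdateAlgebra A] :
    ∃ (X Y : Type u), Nonempty X ∧ Nonempty Y ∧ ∃ f : A → X → Part Y,
      Function.Injective f ∧ ∀ p, IsPointHom fun a => f a p := by
  have hex : ∀ p : A × A, ∃ (Y : Type u) (h : A → Part Y),
      IsPointHom h ∧ (p.1 ≠ p.2 → h p.1 ≠ h p.2) := by
    intro p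
    by_cases hp : p.1 = p.2
    · exact ⟨_, _, isPointHom_principal p.1, fun h => absurd hp h⟩
    · obtain ⟨Y, h, hh, hne⟩ := exists_pointHom hp
      exact ⟨Y, h, hh, fun _ => hne⟩
  choose Y h hh hne using hex
  -- The extra point, where everything is undefined, and the extra value keep both sets nonempty
  -- even for empty `A`.
  let f : A → Option (A × A) → Part (Option (Σ p, Y p)) := fun a q =>
    match q with
    | none => Part.none
    | some p => (h p a).map fun y => some ⟨p, y⟩
  refine ⟨Option (A × A), Option (Σ p, Y p), ⟨none⟩, ⟨none⟩, f, ?_, ?_⟩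
  · intro a b hab
    by_contra hne'
    refine hne (a, b) hne' ?_
    have h1 : (h (a, b) a).map (fun y => some (⟨(a, b), y⟩ : Σ p, Y p)) =
        (h (a, b) b).map (fun y => some (⟨(a, b), y⟩ : Σ p, Y p)) := congrFun hab (some (a, b))
    ext y
    have h2 : ∀ c, y ∈ h (a, b) c ↔
        some (⟨(a, b), y⟩ : Σ p, Y p) ∈
          (h (a, b) c).map (fun y => some (⟨(a, b), y⟩ : Σ p, Y p)) := by
      intro c
      simp [Part.mem_map_iff]
    rw [h2, h2, h1]
  · rintro (_ | p)
    · constructor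
      · intro x y
        simp [f, partOv]
      · intro x y
        simp [f, partUpd]
    · exact (hh p).map _

end Point

end OverrideUpdateAlgebra

/-! ### Algebras of partial functions -/

namespace OUTerm

variable {A : Type*} [OULang.Structure A]

theorem realize_ov (s t : OUTerm) (v : ℕ → A) :
    (ov s t).realize v = FirstOrder.Language.Structure.funMap (L := OULang)
      OUFunctions.override ![s.realize v, t.realize v] :=
  FirstOrder.Language.Term.realize_functions_apply₂

theorem realize_upd (s t : OUTerm) (v : ℕ → A) :
    (upd s t).realize v = FirstOrder.Language.Structure.funMap (L := OULang)
      OUFunctions.update ![s.realize v, t.realize v] :=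
  FirstOrder.Language.Term.realize_functions_apply₂

end OUTerm

namespace PartialFunction

open OverrideUpdateAlgebra

variable {X Y : Type*}

theorem override_apply (f g : X →. Y) (p : X) : override f g p = partOv (f p) (g p) := rfl

theorem update_apply (f g : X →. Y) (p : X) : update f g p = partUpd (f p) (g p) := by
  by_cases hf : (f p).Dom
  · rw [partUpd, if_pos hf, ← override_apply]
    refine Part.ext' ?_ fun _ _ => rfl
    exact ⟨fun _ => dom_subset_dom_override f g hf, fun _ => hf⟩
  · rw [partUpd, if_neg hf]
    exact part_eq_none hf

/-- The algebra of partial functions satisfies the laws of override and update. -/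
theorem laws_hold : ∀ e ∈ overrideUpdateLaws, e.Holds (X →. Y) := by
  have hov : ∀ (s t : OUTerm) (v : ℕ → X →. Y) (p : X),
      (OUTerm.ov s t).realize v p = partOv (s.realize v p) (t.realize v p) := by
    intro s t v p
    rw [OUTerm.realize_ov]
    exact override_apply _ _ p
  have hupd : ∀ (s t : OUTerm) (v : ℕ → X →. Y) (p : X),
      (OUTerm.upd s t).realize v p = partUpd (s.realize v p) (t.realize v p) := by
    intro s t v p
    rw [OUTerm.realize_upd]
    exact update_apply _ _ p
  intro e he v
  funext p
  simp only [overrideUpdateLaws, Set.mem_insert_iff, Set.mem_singleton_iff] at he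
  generalize hx : (OUTerm.x).realize v p = x
  generalize hy : (OUTerm.y).realize v p = y
  generalize hz : (OUTerm.z).realize v p = z
  generalize hw : (OUTerm.w).realize v p = w
  rcases he with rfl | rfl | rfl | rfl | rfl | rfl | rfl | rfl <;>
    simp only [hov, hupd, hx, hy, hz, hw] <;>
    by_cases hxd : x.Dom <;> by_cases hyd : y.Dom <;> by_cases hzd : z.Dom <;>
    by_cases hwd : w.Dom <;>
    simp [partOv, partUpd, hxd, hyd, hzd, hwd, part_eq_none]

end PartialFunction

/-! ### Preservation of equations -/

section Preservation

variable {L : FirstOrder.Language.{0, 0}}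

theorem Equation.Holds.of_injective {A B : Type*} [L.Structure A] [L.Structure B] {e : Equation L}
    (f : A →[L] B) (hf : Function.Injective f) (h : e.Holds B) : e.Holds A := by
  intro v
  apply hf
  rw [← FirstOrder.Language.HomClass.realize_term, ← FirstOrder.Language.HomClass.realize_term]
  exact h _

theorem Equation.Holds.of_surjective {A B : Type*} [L.Structure A] [L.Structure B] {e : Equation L}
    (f : A →[L] B) (hf : Function.Surjective f) (h : e.Holds A) : e.Holds B := by
  intro v
  have hv : v = f ∘ fun n => Function.surjInv hf (v n) :=
    funext fun n => (Function.surjInv_eq hf (v n)).symm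
  rw [hv, FirstOrder.Language.HomClass.realize_term, FirstOrder.Language.HomClass.realize_term, h]

theorem Equation.Holds.pi {ι : Type u} {A : ι → Type u} [∀ i, L.Structure (A i)] {e : Equation L}
    (h : ∀ i, e.Holds (A i)) : @Equation.Holds L e (∀ i, A i) (productStructure L A) := by
  let := productStructure L A
  intro v
  funext i
  let f : (∀ i, A i) →[L] A i :=
    { toFun := fun a => a i
      map_fun' := fun _ _ => rfl
      map_rel' := fun _ _ hr => hr i }
  have hf : ∀ t : L.Term ℕ, t.realize v i = t.realize (f ∘ v) :=
    fun t => (FirstOrder.Language.HomClass.realize_term f).symm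
  rw [hf, hf, h i]

/-- A class axiomatised by equations is a variety as soon as it has a nonempty member. -/
theorem Axiomatises.isVariety {E : Set (Equation L)}
    {K : ∀ (A : Type u) [L.Structure A], Prop} (hE : Axiomatises E K)
    (hne : ∃ (A : Type u) (_ : L.Structure A), Nonempty A ∧ K A) : IsVariety K where
  nonempty := hne
  image A B _ _ f hf hA :=
    (hE B).1 fun e he => ((hE A).2 hA e he).of_surjective f hf
  subalgebra A _ S hA :=
    (hE S).1 fun e he =>
      ((hE A).2 hA e he).of_injective S.subtype.toHom Subtype.val_injective
  product ι A _ hA := by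
    let := productStructure L A
    exact (hE _).1 fun e he => Equation.Holds.pi fun i => (hE (A i)).2 (hA i) e he

end Preservation

/-! ### Axiomatisation of the representable algebras -/

section Representable

open OverrideUpdateAlgebra

/-- An algebra satisfying the laws, as an override-update algebra. -/
abbrev overrideUpdateAlgebraOfLaws {A : Type u} [OULang.Structure A]
    (h : ∀ e ∈ overrideUpdateLaws, e.Holds A) : OverrideUpdateAlgebra A :=
  -- Three values suffice: the law containing `w` is not used.
  let v : A → A → A → ℕ → A := fun x y z n =>
    match n with
    | 0 => x
    | 1 => y
    | _ => z
  have hv : ∀ e ∈ overrideUpdateLaws, ∀ x y z,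
      e.lhs.realize (v x y z) = e.rhs.realize (v x y z) := fun e he x y z => h e he _
  { ov := fun x y => FirstOrder.Language.Structure.funMap (L := OULang) OUFunctions.override ![x, y]
    upd := fun x y => FirstOrder.Language.Structure.funMap (L := OULang) OUFunctions.update ![x, y]
    upd_ov_self := fun x y => by
      simpa [OUTerm.realize_ov, OUTerm.realize_upd, OUTerm.x, OUTerm.y, v] using
        (hv ⟨_, _⟩ (Or.inl rfl) x y x).symm
    ov_eq := fun x y => by
      simpa [OUTerm.realize_ov, OUTerm.realize_upd, OUTerm.x, OUTerm.y, v] using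
        hv ⟨_, _⟩ (Or.inr (Or.inl rfl)) x y x
    upd_upd := fun x y z => by
      simpa [OUTerm.realize_ov, OUTerm.realize_upd, OUTerm.x, OUTerm.y, OUTerm.z, v] using
        hv ⟨_, _⟩ (Or.inr (Or.inr (Or.inl rfl))) x y z
    ov_upd := fun x y z => by
      simpa [OUTerm.realize_ov, OUTerm.realize_upd, OUTerm.x, OUTerm.y, OUTerm.z, v] using
        hv ⟨_, _⟩ (Or.inr (Or.inr (Or.inr (Or.inl rfl)))) x y z
    upd_upd_upd := fun x y z => by
      simpa [OUTerm.realize_ov, OUTerm.realize_upd, OUTerm.x, OUTerm.y, OUTerm.z, v] using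
        hv ⟨_, _⟩ (Or.inr (Or.inr (Or.inr (Or.inr (Or.inl rfl))))) x y z
    ov_assoc := fun x y z => by
      simpa [OUTerm.realize_ov, OUTerm.realize_upd, OUTerm.x, OUTerm.y, OUTerm.z, v] using
        hv ⟨_, _⟩ (Or.inr (Or.inr (Or.inr (Or.inr (Or.inr (Or.inr (Or.inl rfl))))))) x y z
    ov_self := fun x => by
      simpa [OUTerm.realize_ov, OUTerm.realize_upd, OUTerm.x, OUTerm.y, OUTerm.z, v] using
        hv ⟨_, _⟩ (Or.inr (Or.inr (Or.inr (Or.inr (Or.inr (Or.inr (Or.inr rfl))))))) x x x }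

theorem IsRepresentable.laws_hold {A : Type u} [OULang.Structure A] (h : IsRepresentable A) :
    ∀ e ∈ overrideUpdateLaws, e.Holds A := by
  obtain ⟨X, Y, -, -, S, ⟨i⟩⟩ := h
  intro e he
  exact ((PartialFunction.laws_hold e he).of_injective S.subtype.toHom
    Subtype.val_injective).of_injective i.toHom i.injective

theorem isRepresentable_of_laws {A : Type u} [OULang.Structure A]
    (h : ∀ e ∈ overrideUpdateLaws, e.Holds A) : IsRepresentable A := by
  let := overrideUpdateAlgebraOfLaws h
  obtain ⟨X, Y, hX, hY, f, hf, hp⟩ := exists_embedding A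
  have hfun : ∀ {n} (s : OULang.Functions n) (a : Fin n → A),
      f (FirstOrder.Language.Structure.funMap s a) =
        FirstOrder.Language.Structure.funMap (M := X →. Y) s (f ∘ a) := by
    intro n s a
    cases s with
    | override =>
      have ha : a = ![a 0, a 1] := by
        ext i
        fin_cases i <;> rfl
      funext p
      rw [ha]
      exact ((hp p).ov (a 0) (a 1)).trans
        (PartialFunction.override_apply (f (a 0)) (f (a 1)) p).symm
    | update =>
      have ha : a = ![a 0, a 1] := by
        ext i
        fin_cases i <;> rfl
      funext p
      rw [ha]
      exact ((hp p).upd (a 0) (a 1)).trans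
        (PartialFunction.update_apply (f (a 0)) (f (a 1)) p).symm
  let g : A ↪[OULang] (X →. Y) :=
    { toFun := f
      inj' := hf
      map_fun' := hfun
      map_rel' := fun r => Empty.elim r }
  exact ⟨X, Y, hX, hY, g.toHom.range, ⟨g.equivRange⟩⟩

theorem axiomatises_isRepresentable :
    Axiomatises overrideUpdateLaws
      (fun (A : Type u) [OULang.Structure A] => IsRepresentable A) :=
  fun _ _ => ⟨isRepresentable_of_laws, IsRepresentable.laws_hold⟩

end Representable

theorem theorem4p1 :
    overrideUpdateLaws.Finite ∧
    Axiomatises overrideUpdateLaws (fun (A : Type u) [OULang.Structure A] => IsRepresentable A) ∧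
    IsFinitelyBasedVariety (fun (A : Type u) [OULang.Structure A] => IsRepresentable A) := by
  have hfin : overrideUpdateLaws.Finite := by
    unfold overrideUpdateLaws
    exact Set.toFinite _
  refine ⟨hfin, axiomatises_isRepresentable,
    axiomatises_isRepresentable.isVariety ?_, _, hfin, axiomatises_isRepresentable⟩
  exact ⟨PUnit.{u + 1} →. PUnit.{u + 1}, inferInstance, ⟨fun _ => Part.none⟩,
    isRepresentable_of_laws PartialFunction.laws_hold⟩
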